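/- For a set $X$ and $k\in\mathbb N$ let $\sigma_k(2^X)=\{\chi_A : A\subseteq X,\ |A|\le k\}\subseteq\{0,1\}^X$, a compact space with the product topology, and let $C(\sigma_k(2^X))$ be the Banach space of real continuous functions on it with the supremum norm. For $m<n$, a bounded linear operator $T:C(\sigma_m(2^X))\to C(\sigma_n(2^X))$ is an extension operator if $Tf$ extends $f$ for every $f$. For an injection $u:Y\to X$ and $k\in\mathbb N$ let $e_u:C(\sigma_k(2^Y))\to C(\sigma_k(2^X))$ be given by $e_u(f)(\chi_A)=f(\chi_{u^{-1}(A)})$. For a finite set $X$, let $T_X:C(\sigma_m(2^X))\to C(\sigma_n(2^X))$ be the canonical operator, given by $T_X(f)(\chi_A)=f(\chi_A)$ if $|A|\le m$ and $$T_X(f)(\chi_A)=\sum_{B\subseteq A,\ |B|\le m}(-1)^{m-|B|}\binom{|A|-|B|-1}{m-|B|}f(\chi_B)\quad\text{if } |A|>m.$$ Theorem. Let $m<n$ be positive integers. Suppose that $M>0$ and that for each finite set $X$ we have an extension operator $\tilde T_X:C(\sigma_m(2^X))\to C(\sigma_n(2^X))$ with $\|\tilde T_X\|\le M$, such that $\tilde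 T_X\circ e_u=e_u\circ\tilde T_Y$ for every injective map $u:Y\to X$ between finite sets. Then $\tilde T_X=T_X$ for every finite set $X$. Moreover, the operators $T_X$ themselves form such a family (they are extension operators with uniformly bounded norms and $T_X\circ e_u=e_u\circ T_Y$ for all such $u$), so that they are the unique natural uniformly bounded family of extension operators. -/

import Mathlib

open Set Topology

universe u

noncomputable section

namespace SigmaSpace

/-- The set `A` of which `x = χ_A` is the characteristic function; here `2 = Bool`, with `true`
in the role of `1`. -/
def supp {X : Type u} (x : X → Bool) : Set X := {i | x i = true}

/-- The space `σ_n(2^X)` of the characteristic functions of the subsets of `X` with at most `n`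
elements, as a subspace of the product space `2^X` (each factor being discrete). -/
def sigma (n : ℕ) (X : Type u) : Set (X → Bool) := {x | (supp x).encard ≤ n}

theorem isClosed_sigma (n : ℕ) (X : Type u) : IsClosed (sigma n X) := by
  rw [← isOpen_compl_iff, isOpen_iff_mem_nhds]
  intro x hx
  have hx' : ((n + 1 : ℕ) : ℕ∞) ≤ (supp x).encard := by
    have h : (n : ℕ∞) < (supp x).encard := not_le.1 hx
    rw [Nat.cast_add, Nat.cast_one]
    exact Order.add_one_le_of_lt h
  obtain ⟨t, hts, htc⟩ := Set.exists_subset_encard_eq hx'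
  have htf : t.Finite := Set.finite_of_encard_eq_coe htc
  have hopen : IsOpen (⋂ i ∈ t, {y : X → Bool | y i = true}) := by
    refine htf.isOpen_biInter fun i _ => ?_
    exact (isOpen_discrete ({true} : Set Bool)).preimage
      (continuous_apply i : Continuous fun y : X → Bool => y i)
  refine Filter.mem_of_superset (hopen.mem_nhds ?_) ?_
  · simp only [mem_iInter]
    exact fun i hi => hts hi
  · intro y hy hy'
    simp only [mem_iInter] at hy
    have h1 : t ⊆ supp y := fun i hi => hy i hi
    have h2 := (Set.encard_le_encard h1).trans hy'
    rw [htc] at h2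
    exact absurd (Nat.cast_le.1 h2) (by omega)

instance compactSpace_sigma (n : ℕ) (X : Type u) : CompactSpace (sigma n X) :=
  isCompact_iff_compactSpace.1 (isClosed_sigma n X).isCompact

/-- A bounded operator `T : C(σ_m(2^X)) → C(σ_n(2^X))` is an extension operator if `T f` extends
`f` for all `f` (for `m ≤ n`, so that `σ_m(2^X) ⊆ σ_n(2^X)`). -/
def IsExtensionOperator {m n : ℕ} {X : Type u}
    (T : C(sigma m X, ℝ) →L[ℝ] C(sigma n X, ℝ)) : Prop :=
  ∀ (f : C(sigma m X, ℝ)) (x : X → Bool) (hm : x ∈ sigma m X) (hn : x ∈ sigma n X),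
    T f ⟨x, hn⟩ = f ⟨x, hm⟩

/-- The continuous map `σ_n(2^X) → σ_n(2^Y)`, `χ_A ↦ χ_{u⁻¹(A)}`, for an injection `u : Y → X`. -/
def pull (n : ℕ) {X Y : Type u} (u : Y ↪ X) : C(sigma n X, sigma n Y) where
  toFun x := ⟨fun y => x.1 (u y), by
    have h : u '' supp (fun y => x.1 (u y)) ⊆ supp x.1 := by
      rintro _ ⟨y, hy, rfl⟩
      exact hy
    have h2 := Set.encard_le_encard h
    rw [u.injective.encard_image] at h2
    exact h2.trans x.2⟩
  continuous_toFun := by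
    refine Continuous.subtype_mk (continuous_pi fun y => ?_) _
    exact (continuous_apply (u y)).comp continuous_subtype_val

/-- The operator `e_u : C(σ_n(2^Y)) → C(σ_n(2^X))`, `e_u(f)(χ_A) = f(χ_{u⁻¹(A)})`. -/
def e (n : ℕ) {X Y : Type u} (u : Y ↪ X) (f : C(sigma n Y, ℝ)) : C(sigma n X, ℝ) :=
  f.comp (pull n u)

open Classical in
/-- The value `T_X(f)(χ_A)` of the canonical operator: for `|A| > m` it is the sum over all
`B ⊆ A` with `|B| ≤ m` of `(-1)^(m-|B|) * binom(|A|-|B|-1, m-|B|) * f(χ_B)`, and for `|A| ≤ m` it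
is `f(χ_A)`. The natural-number subtractions are never truncated, since `|B| ≤ m < |A|`. -/
def canonicalValue {m n : ℕ} {X : Type u} (f : sigma m X → ℝ) (a : sigma n X) : ℝ :=
  if h : a.1 ∈ sigma m X then f ⟨a.1, h⟩
  else ∑ᶠ b ∈ {b : sigma m X | supp b.1 ⊆ supp a.1},
    (-1 : ℝ) ^ (m - (supp b.1).ncard) *
      (((supp a.1).ncard - (supp b.1).ncard - 1).choose (m - (supp b.1).ncard) : ℝ) * f b

/-- For finite `X` the space `C(σ_m(2^X))` is finite-dimensional. -/
instance finiteDimensional_C (m : ℕ) (X : Type u) [Finite X] :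
    FiniteDimensional ℝ C(sigma m X, ℝ) :=
  FiniteDimensional.of_injective (ContinuousMap.coeFnLinearMap ℝ)
    (fun _ _ h => DFunLike.coe_injective h)

/-- The canonical operator `T_X : C(σ_m(2^X)) → C(σ_n(2^X))` for a finite set `X`. -/
def canonical (m n : ℕ) (X : Type u) [Finite X] : C(sigma m X, ℝ) →L[ℝ] C(sigma n X, ℝ) :=
  LinearMap.toContinuousLinearMap
    { toFun := fun f => ⟨fun a => canonicalValue f a, continuous_of_discreteTopology⟩
      map_add' := by
        intro f g
        ext a
        simp only [ContinuousMap.coe_mk, ContinuousMap.add_apply, canonicalValue]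
        split_ifs with h
        · rfl
        · rw [← finsum_mem_add_distrib (Set.toFinite _)]
          simp only [mul_add]
      map_smul' := by
        intro c f
        ext a
        simp only [ContinuousMap.coe_mk, ContinuousMap.smul_apply, canonicalValue, smul_eq_mul,
          RingHom.id_apply]
        split_ifs with h
        · rfl
        · rw [← smul_eq_mul, smul_finsum_mem (Set.toFinite _)]
          refine finsum_mem_congr rfl fun b _ => ?_
          rw [smul_eq_mul]
          ring }

theorem canonical_apply (m n : ℕ) (X : Type u) [Finite X] (f : C(sigma m X, ℝ)) (a : sigma n X) :
    canonical m n X f a = canonicalValue f a := rfl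

/-- A natural, uniformly bounded family of extension operators, one for each finite set `X`. -/
structure IsNaturalBoundedFamily {m n : ℕ}
    (T : ∀ (X : Type u) [Finite X], C(sigma m X, ℝ) →L[ℝ] C(sigma n X, ℝ)) : Prop where
  extension : ∀ (X : Type u) [Finite X], IsExtensionOperator (T X)
  bounded : ∃ M : ℝ, 0 < M ∧ ∀ (X : Type u) [Finite X], ‖T X‖ ≤ M
  natural : ∀ (X Y : Type u) [Finite X] [Finite Y] (u : Y ↪ X) (f : C(sigma m Y, ℝ)),
    T X (e m u f) = e n u (T Y f)

end SigmaSpace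

end

namespace SigmaSpace

/-! For finite `X`, the monomials `χ_A ↦ [D ⊆ A]` with `|D| ≤ m` span `C(σ_m(2^X))`
(`linearMap_ext_monomial`), so it suffices to know an operator on them. Naturality reduces the
monomial of `D` to the case `X = D`; there `σ_m(2^D)` is all of `2^D`, and the extension property
alone forces the value (`apply_monomial_of_natural`). The canonical operator also sends each
monomial to the same monomial, by a binomial identity (`canonical_monomial`). This gives both
uniqueness and the naturality of `T_X`. -/

/-! ### The binomial identity -/

theorem alternating_sum_choose_mul_choose (M : ℕ) : ∀ N : ℕ, M < N →
    ∑ k ∈ Finset.range (M + 1),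
      (-1 : ℝ) ^ (M - k) * ((N - k - 1).choose (M - k) : ℝ) * (N.choose k : ℝ) = 1 := by
  induction M with
  | zero => intro N _; simp
  | succ M ih =>
    intro N hN
    obtain ⟨N, rfl⟩ : ∃ N', N = N' + 1 := ⟨N - 1, by omega⟩
    -- Pascal's rule on `(N + 1).choose k` splits the sum in two: this part, a multiple of an
    -- alternating row sum, and the induction hypothesis at `N` after shifting `k`.
    have hzero : ∑ k ∈ Finset.range (M + 1 + 1),
        (-1 : ℝ) ^ (M + 1 - k) * ((N - k).choose (M + 1 - k) : ℝ) * (N.choose k : ℝ) = 0 := by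
      have halt : ∑ k ∈ Finset.range (M + 1 + 1), (-1 : ℝ) ^ k * ((M + 1).choose k : ℝ) = 0 := by
        have h := Int.alternating_sum_range_choose_of_ne (n := M + 1) (by omega)
        exact_mod_cast h
      calc _ = ∑ k ∈ Finset.range (M + 1 + 1), (-1 : ℝ) ^ (M + 1) * (N.choose (M + 1) : ℝ) *
            ((-1 : ℝ) ^ k * ((M + 1).choose k : ℝ)) := by
            refine Finset.sum_congr rfl fun k hk => ?_
            have hk' : k ≤ M + 1 := by simpa [Nat.lt_succ_iff] using hk
            have hc := Nat.choose_mul (n := N) (k := M + 1) (s := k) hk'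
            have hc' : (N.choose (M + 1) : ℝ) * ((M + 1).choose k : ℝ) =
              (N.choose k : ℝ) * ((N - k).choose (M + 1 - k) : ℝ) := by exact_mod_cast hc
            have hs : (-1 : ℝ) ^ (M + 1 - k) = (-1) ^ (M + 1) * (-1) ^ k := by
              rw [← pow_add, show M + 1 + k = (M + 1 - k) + 2 * k by omega, pow_add, pow_mul]
              simp
            rw [hs]
            linear_combination (-(-1 : ℝ) ^ (M + 1) * (-1) ^ k) * hc'
        _ = 0 := by rw [← Finset.mul_sum, halt, mul_zero]
    have hrec := ih N (by omega)
    refine Eq.trans ?_ ((congrArg₂ (· + ·) hzero hrec).trans (zero_add 1))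
    rw [Finset.sum_range_succ' _ (M + 1), Finset.sum_range_succ' _ (M + 1)]
    simp only [Nat.choose_succ_succ, Nat.cast_add, Nat.add_sub_add_right, Nat.choose_zero_right,
      show ∀ k, N - (k + 1) = N - k - 1 from fun k => by omega,
      show N + 1 - 0 - 1 = N - 0 by omega, mul_add, Finset.sum_add_distrib]
    ring

/-! ### Monomials as a spanning set -/

/-- A subspace of the functions on a finite ordered set that contains the indicators of all
principal up-sets is everything. -/
theorem eq_top_of_Ici_indicator_mem {P : Type*} [Finite P] [PartialOrder P] [TopologicalSpace P]
    [DiscreteTopology P] (S : Submodule ℝ C(P, ℝ))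
    (h : ∀ d, ∃ f ∈ S, ∀ x, f x = (Ici d).indicator 1 x) : S = ⊤ := by
  classical
  have := Fintype.ofFinite P
  let δ : P → C(P, ℝ) := fun d => ⟨Pi.single d 1, continuous_of_discreteTopology⟩
  have hδ : ∀ d, δ d ∈ S := by
    intro d
    -- Downward induction: the point mass at `d` is the up-set indicator minus the point masses
    -- strictly above `d`.
    induction d using WellFoundedGT.induction with
    | ind d ih =>
      obtain ⟨f, hf, hfx⟩ := h d
      have : δ d = f - ∑ x ∈ Finset.univ.filter (d < ·), δ x := by
        ext y
        simp only [ContinuousMap.sub_apply, ContinuousMap.sum_apply, hfx, δ, ContinuousMap.coe_mk,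
          Pi.single_apply, Finset.sum_ite_eq, Finset.mem_filter, Finset.mem_univ, true_and,
          indicator_apply, mem_Ici, Pi.one_apply]
        rcases eq_or_ne y d with rfl | hne
        · simp
        · by_cases hd : d ≤ y
          · simp [hne, hd, lt_of_le_of_ne hd hne.symm]
          · simpa [hne, hd] using fun h : d < y => hd h.le
      rw [this]
      exact S.sub_mem hf (S.sum_mem fun x hx => ih x (Finset.mem_filter.1 hx).2)
  refine eq_top_iff.2 fun f _ => ?_
  have : f = ∑ d, f d • δ d := by
    ext y
    simp [δ, ContinuousMap.sum_apply, Pi.single_apply]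
  rw [this]
  exact S.sum_mem fun d _ => S.smul_mem _ (hδ d)

open Classical in
/-- The monomial `χ_A ↦ [D ⊆ A]` on `σ_k(2^X)`. -/
noncomputable def monomial (k : ℕ) {X : Type u} [Finite X] (D : Set X) : C(sigma k X, ℝ) :=
  ⟨fun x => if D ⊆ supp x.1 then 1 else 0, continuous_of_discreteTopology⟩

open Classical in
theorem monomial_apply (k : ℕ) {X : Type u} [Finite X] (D : Set X) (x : sigma k X) :
    monomial k D x = if D ⊆ supp x.1 then 1 else 0 := rfl

theorem le_iff_supp_subset {X : Type u} (x y : X → Bool) : x ≤ y ↔ supp x ⊆ supp y :=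
  forall_congr' fun _ => Bool.le_iff_imp

/-- In the pointwise order on `σ_m(2^X)`, the monomial of `supp d` is the indicator of the up-set of
`d`. -/
theorem linearMap_ext_monomial {m : ℕ} {X : Type u} [Finite X] {V : Type*} [AddCommGroup V]
    [Module ℝ V] {F G : C(sigma m X, ℝ) →ₗ[ℝ] V}
    (h : ∀ D : Set X, D.encard ≤ m → F (monomial m D) = G (monomial m D)) : F = G := by
  rw [← LinearMap.eqLocus_eq_top]
  refine eq_top_of_Ici_indicator_mem _ fun d => ⟨monomial m (supp d.1), h _ d.2, fun x => ?_⟩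
  classical
  simp only [monomial_apply, indicator_apply, mem_Ici, Pi.one_apply, ← Subtype.coe_le_coe,
    le_iff_supp_subset]

theorem e_monomial (k : ℕ) {X Y : Type u} [Finite X] [Finite Y] (u : Y ↪ X) (D : Set Y) :
    e k u (monomial k D) = monomial k (u '' D) := by
  classical
  ext x
  change (if D ⊆ supp (fun y => x.1 (u y)) then (1 : ℝ) else 0) = if u '' D ⊆ supp x.1 then 1 else 0
  simp only [image_subset_iff]
  rfl

/-- The operator `e_u` as a linear map. -/
noncomputable def eLinear (k : ℕ) {X Y : Type u} (u : Y ↪ X) : C(sigma k Y, ℝ) →ₗ[ℝ] C(sigma k X, ℝ) where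
  toFun := e k u
  map_add' _ _ := rfl
  map_smul' _ _ := rfl

/-! ### The canonical operator -/

open Classical in
/-- The characteristic function of a finite set. -/
noncomputable def char {X : Type u} (B : Finset X) : X → Bool := fun i => decide (i ∈ B)

theorem supp_char {X : Type u} (B : Finset X) : supp (char B) = B := by
  ext i
  simp [supp, char]

theorem char_mem_sigma {X : Type u} {m : ℕ} {B : Finset X} : char B ∈ sigma m X ↔ B.card ≤ m := by
  change (supp (char B)).encard ≤ m ↔ _
  rw [supp_char, encard_coe_eq_coe_finsetCard, Nat.cast_le]

theorem supp_injective {X : Type u} : Function.Injective (supp : (X → Bool) → Set X) :=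
  fun _ _ h => funext fun i => Bool.eq_iff_iff.2 (Set.ext_iff.1 h i)

open Classical in
theorem finsum_mem_supp_subset {X : Type u} [Finite X] {m : ℕ} (A : Finset X)
    (G : sigma m X → ℝ) :
    ∑ᶠ b ∈ {b : sigma m X | supp b.1 ⊆ A}, G b =
      ∑ B ∈ A.powerset, if h : char B ∈ sigma m X then G ⟨char B, h⟩ else 0 := by
  have := Fintype.ofFinite X
  have hs : {b : sigma m X | supp b.1 ⊆ A} =
      ((Finset.univ.filter fun b : sigma m X => supp b.1 ⊆ A) : Finset (sigma m X)) := by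
    ext b; simp
  rw [hs, finsum_mem_coe_finset]
  have hchar : ∀ x : X → Bool, char (supp x).toFinset = x := fun x =>
    supp_injective (by rw [supp_char, coe_toFinset])
  refine Finset.sum_bij_ne_zero (fun b _ _ => (supp b.1).toFinset) ?_ ?_ ?_ ?_
  · intro b hb _
    simpa [← Finset.coe_subset] using hb
  · intro b _ _ c _ _ h
    exact Subtype.ext (by rw [← hchar b.1, h, hchar])
  · intro B hB h
    have hB' : char B ∈ sigma m X := by
      by_contra h'
      exact h (dif_neg h')
    refine ⟨⟨char B, hB'⟩, ?_, ?_, ?_⟩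
    · simpa [supp_char] using hB
    · rwa [dif_pos hB'] at h
    · simp [supp_char]
  · intro b _ _
    have hb : char (supp b.1).toFinset ∈ sigma m X := by rw [hchar]; exact b.2
    rw [dif_pos hb]
    exact congrArg G (Subtype.ext (hchar b.1).symm)

open Classical in
theorem canonicalValue_of_lt {m n : ℕ} {X : Type u} [Finite X] (f : sigma m X → ℝ)
    {A : Finset X} (hA : m < A.card) (ha : char A ∈ sigma n X) :
    canonicalValue f ⟨char A, ha⟩ =
      ∑ B ∈ A.powerset, if h : char B ∈ sigma m X then
        (-1 : ℝ) ^ (m - B.card) * ((A.card - B.card - 1).choose (m - B.card) : ℝ) * f ⟨char B, h⟩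
      else 0 := by
  have hn : char A ∉ sigma m X := by rw [char_mem_sigma]; omega
  rw [canonicalValue, dif_neg hn]
  simp only [supp_char]
  rw [finsum_mem_supp_subset]
  simp only [supp_char, ncard_coe_finset]

theorem exists_eq_char {X : Type u} [Finite X] (x : X → Bool) : ∃ A : Finset X, x = char A :=
  ⟨(toFinite (supp x)).toFinset, supp_injective (by simp [supp_char])⟩

theorem canonical_isExtensionOperator (m n : ℕ) (X : Type u) [Finite X] :
    IsExtensionOperator (canonical m n X) := by
  intro f x hm hn
  rw [canonical_apply, canonicalValue, dif_pos hm]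

/-- When `|A| > m`, only `B = D ∪ E` with `E ⊆ A \ D` contribute. Grouping by `|E|` gives the
binomial identity with `M = m - |D|`, `N = |A \ D|`. -/
theorem canonical_monomial (m n : ℕ) {X : Type u} [Finite X] (D : Set X) (hD : D.encard ≤ m) :
    canonical m n X (monomial m D) = monomial n D := by
  classical
  ext ⟨a, ha⟩
  by_cases hm : a ∈ sigma m X
  · rw [canonical_isExtensionOperator m n X _ a hm ha, monomial_apply, monomial_apply]
  obtain ⟨A, rfl⟩ := exists_eq_char a
  obtain ⟨D, rfl⟩ : ∃ D' : Finset X, D = D' := ⟨(toFinite D).toFinset, by simp⟩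
  rw [encard_coe_eq_coe_finsetCard, Nat.cast_le] at hD
  rw [char_mem_sigma, not_le] at hm
  rw [canonical_apply, canonicalValue_of_lt _ hm]
  simp only [monomial_apply, supp_char, char_mem_sigma, Finset.coe_subset, dite_eq_ite]
  by_cases hDA : D ⊆ A
  · have hcard := Finset.card_sdiff_add_card_eq_card hDA
    set M := m - D.card with hM
    set N := (A \ D).card with hN
    -- The cutoff matters: for `k > M` the truncated `M - k = 0` would make the product `1`.
    let g : ℕ → ℝ := fun k =>
      if k ≤ M then (-1 : ℝ) ^ (M - k) * ((N - k - 1).choose (M - k) : ℝ) else 0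
    have hsum : ∑ B ∈ A.powerset, (if B.card ≤ m then
        (-1 : ℝ) ^ (m - B.card) * ((A.card - B.card - 1).choose (m - B.card) : ℝ) *
          (if D ⊆ B then 1 else 0) else 0) = ∑ E ∈ (A \ D).powerset, g E.card := by
      refine Finset.sum_bij_ne_zero (fun B _ _ => B \ D) ?_ ?_ ?_ ?_
      · intro B hB _
        exact Finset.mem_powerset.2 (Finset.sdiff_subset_sdiff (Finset.mem_powerset.1 hB) le_rfl)
      · intro B _ hB C _ hC h
        have hB' : D ⊆ B := by by_contra h'; simp [h'] at hB
        have hC' : D ⊆ C := by by_contra h'; simp [h'] at hC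
        rw [← Finset.sdiff_union_of_subset hB', h, Finset.sdiff_union_of_subset hC']
      · intro E hE hg
        rw [Finset.mem_powerset] at hE
        have hdisj : Disjoint E D := Finset.disjoint_of_subset_left hE Finset.sdiff_disjoint
        have hc := Finset.card_union_of_disjoint hdisj
        have hEM : E.card ≤ M := by by_contra h'; simp [g, h'] at hg
        refine ⟨E ∪ D, ?_, ?_, ?_⟩
        · exact Finset.mem_powerset.2
            (Finset.union_subset (hE.trans Finset.sdiff_subset) hDA)
        · rw [if_pos (by omega), if_pos Finset.subset_union_right, hc,
            show m - (E.card + D.card) = M - E.card by omega,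
            show A.card - (E.card + D.card) - 1 = N - E.card - 1 by omega, mul_one]
          simpa only [g, if_pos hEM] using hg
        · rw [Finset.union_sdiff_cancel_right hdisj]
      · intro B _ hB
        have hB' : D ⊆ B := by by_contra h'; simp [h'] at hB
        have hBm : B.card ≤ m := by by_contra h'; simp [h'] at hB
        have hc := Finset.card_sdiff_add_card_eq_card hB'
        simp only [g]
        rw [if_pos hBm, if_pos hB', if_pos (by omega), mul_one,
          show m - B.card = M - (B \ D).card by omega,
          show A.card - B.card - 1 = N - (B \ D).card - 1 by omega]
    rw [hsum, if_pos hDA, Finset.sum_powerset_apply_card, ← hN,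
      ← alternating_sum_choose_mul_choose M N (by omega)]
    symm
    refine Finset.sum_subset_zero_on_sdiff
      (Finset.range_subset_range.2 (by omega)) (fun k hk => ?_) (fun k hk => ?_)
    · have : ¬ k ≤ M := by simp at hk; omega
      simp [g, this]
    · have : k ≤ M := by simp at hk; omega
      simp only [g, if_pos this, nsmul_eq_mul]
      ring
  · rw [if_neg hDA]
    refine Finset.sum_eq_zero fun B hB => ?_
    rw [if_neg (fun h : D ⊆ B => hDA (h.trans (Finset.mem_powerset.1 hB)))]
    simp

/-- Since `|A| ≤ n`, there are at most `2 ^ n` summands, with coefficients at most `2 ^ n` in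
absolute value, whatever `X` is. -/
theorem norm_canonical_le (m n : ℕ) (X : Type u) [Finite X] :
    ‖canonical m n X‖ ≤ 2 ^ n * 2 ^ n := by
  classical
  refine ContinuousLinearMap.opNorm_le_bound _ (by positivity) fun f => ?_
  refine (ContinuousMap.norm_le _ (by positivity)).2 fun ⟨a, ha⟩ => ?_
  by_cases hm : a ∈ sigma m X
  · rw [canonical_isExtensionOperator m n X f a hm ha]
    refine (f.norm_coe_le_norm _).trans (le_mul_of_one_le_left (norm_nonneg _) ?_)
    exact one_le_mul_of_one_le_of_one_le (one_le_pow₀ one_le_two) (one_le_pow₀ one_le_two)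
  obtain ⟨A, rfl⟩ := exists_eq_char a
  have hA := char_mem_sigma.1 ha
  rw [char_mem_sigma, not_le] at hm
  rw [canonical_apply, canonicalValue_of_lt _ hm]
  have hterm : ∀ B ∈ A.powerset, ‖if h : char B ∈ sigma m X then
      (-1 : ℝ) ^ (m - B.card) * ((A.card - B.card - 1).choose (m - B.card) : ℝ) * f ⟨char B, h⟩
      else 0‖ ≤ 2 ^ n * ‖f‖ := by
    intro B _
    split_ifs with h
    · rw [norm_mul, norm_mul, norm_pow, norm_neg, norm_one, one_pow, one_mul, Real.norm_natCast]
      refine mul_le_mul ?_ (f.norm_coe_le_norm _) (norm_nonneg _) (by positivity)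
      have h1 := (Nat.choose_le_two_pow (A.card - B.card - 1) (m - B.card)).trans
        (Nat.pow_le_pow_right two_pos (show A.card - B.card - 1 ≤ n by omega))
      exact_mod_cast h1
    · rw [norm_zero]; positivity
  refine (norm_sum_le_of_le _ hterm).trans ?_
  rw [Finset.sum_const, Finset.card_powerset, nsmul_eq_mul, ← mul_assoc]
  push_cast
  gcongr
  exact one_le_two

theorem canonical_natural (m n : ℕ) {X Y : Type u} [Finite X] [Finite Y] (u : Y ↪ X)
    (f : C(sigma m Y, ℝ)) : canonical m n X (e m u f) = e n u (canonical m n Y f) := by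
  have h : (canonical m n X).toLinearMap ∘ₗ eLinear m u =
      eLinear n u ∘ₗ (canonical m n Y).toLinearMap := by
    refine linearMap_ext_monomial fun D hD => ?_
    change canonical m n X (e m u (monomial m D)) = e n u (canonical m n Y (monomial m D))
    rw [e_monomial, canonical_monomial m n _ (by rwa [u.injective.encard_image]),
      canonical_monomial m n D hD, e_monomial]
  exact LinearMap.congr_fun h f

/-! ### Rigidity of natural families -/

/-- A natural family of extension operators fixes the monomials: a monomial of degree at most `m`
comes from a set with at most `m` elements, where there is nothing to extend. -/
theorem apply_monomial_of_natural {m n : ℕ}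
    {T : ∀ (X : Type u) [Finite X], C(sigma m X, ℝ) →L[ℝ] C(sigma n X, ℝ)}
    (ext : ∀ (X : Type u) [Finite X], IsExtensionOperator (T X))
    (nat : ∀ (X Y : Type u) [Finite X] [Finite Y] (u : Y ↪ X) (f : C(sigma m Y, ℝ)),
      T X (e m u f) = e n u (T Y f))
    {X : Type u} [Finite X] (D : Set X) (hD : D.encard ≤ m) :
    T X (monomial m D) = monomial n D := by
  have hu : ∀ k, e k (Function.Embedding.subtype (· ∈ D)) (monomial k (univ : Set D)) =
      monomial k D := fun k => by
    rw [e_monomial]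
    congr 1
    simp
  rw [← hu m, nat, ← hu n]
  congr 1
  ext ⟨y, hy⟩
  -- Every subset of `D` has at most `m` elements, so the extension property applies at every point.
  have hm : y ∈ sigma m D := by
    refine le_trans ?_ hD
    rw [← ENat.card_coe_set_eq D, ← encard_univ]
    exact encard_le_encard (subset_univ _)
  rw [ext _ _ y hm hy]
  rfl

end SigmaSpace

theorem mainTheorem6 (m n : ℕ) (hm : 0 < m) (hmn : m < n) :
    SigmaSpace.IsNaturalBoundedFamily.{u}
      (fun (X : Type u) [Finite X] => SigmaSpace.canonical m n X) ∧
    ∀ T : (∀ (X : Type u) [Finite X],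
        C(SigmaSpace.sigma m X, ℝ) →L[ℝ] C(SigmaSpace.sigma n X, ℝ)),
      SigmaSpace.IsNaturalBoundedFamily.{u} T →
        ∀ (X : Type u) [Finite X], T X = SigmaSpace.canonical m n X := by
  refine ⟨⟨fun X _ => SigmaSpace.canonical_isExtensionOperator m n X,
    ⟨2 ^ n * 2 ^ n, by positivity, fun X _ => SigmaSpace.norm_canonical_le m n X⟩,
    fun X Y _ _ u f => SigmaSpace.canonical_natural m n u f⟩, fun T hT X _ => ?_⟩
  refine ContinuousLinearMap.coe_injective (SigmaSpace.linearMap_ext_monomial fun D hD => ?_)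
  exact (SigmaSpace.apply_monomial_of_natural hT.extension hT.natural D hD).trans
    (SigmaSpace.canonical_monomial m n D hD).symm
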